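/- Let $(X,\|\cdot\|)$ be a two-dimensional real normed space that is smooth (the norm is differentiable away from the origin) and strictly convex, let $S$ be its unit circle, and let $[\cdot,\cdot]$ be a nondegenerate alternating bilinear form on $X$. Write $x\dashv_B y$ if $\|x+ty\|\ge\|x\|$ for all $t\in\mathbb{R}$, and for $v\ne 0$ let $b(v)$ be the unit vector with $v\dashv_B b(v)$ and $[v,b(v)]>0$. Let $S^1=\mathbb{R}/\mathbb{Z}$ and let $\gamma:S^1\to X$ be a closed front with normal field $\eta$; that is, $(\gamma,\eta):S^1\to X\times S$ is $C^\infty$, $\eta(t)\dashv_B\gamma'(t)$ for all $t$, and $\gamma'$, $\eta'$ have no common zero. Suppose that $\gamma$ is generic: at every $t$ with $\gamma'(t)=0$ the vectors $\gamma''(t),\gamma'''(t)$ are linearly independent (an ordinary cusp), and if $s\ne t$ in $S^1$ and $\gamma(s)=\gamma(t)$, then $\eta(s),\eta(t)$ are linearly independent. Then there are functions $\alpha,\kappa:S^1\to\mathbb{R}$ (which are unique) with $\gamma'=\alpha\, b(\eta)$ and $\eta'=\kappa\, b(\eta)$. They have no common zero, and so define a map $k_\gamma=[\alpha:\kappa]:S^1\to\mathrm{P}^1(\mathbb{R})$.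 Let $t_1<\dots<t_m$ be the ordinary cusps of $\gamma$ in $[0,1)$. Attach to $t_i$ the letter $a$ if $[\eta(t_i),\eta'(t_i)]>0$ (a zig) and $b$ if $[\eta(t_i),\eta'(t_i)]<0$ (a zag). The resulting word of length $m$, read in the free product $\mathbb{Z}_2*\mathbb{Z}_2=\langle a,b\mid a^2=b^2=1\rangle$, equals $(ab)^z$ or $(ba)^z$ for a unique integer $z\ge 0$, the zigzag number (Maslov index) of $\gamma$. The zigzag number $z$ equals the rotation number of $k_\gamma$. Here the rotation number is the absolute value of the number of complete turns, counted with sign, that the line $k_\gamma(t)$ makes about the origin as $t$ runs once through $S^1$, a complete turn being a rotation through the angle $2\pi$. Since a rotation of the line through $\pi$ runs once through $\mathrm{P}^1(\mathbb{R})$, this says that $$z=\tfrac12\,\bigl|\deg\bigl(k_\gamma:S^1\to\mathrm{P}^1(\mathbb{R})\bigr)\bigr|.$$ -/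

import Mathlib

open scoped ContDiff

noncomputable section

namespace NormedPlane

/-- Birkhoff orthogonality `x ⊣ y`: `‖x + t y‖ ≥ ‖x‖` for every real `t`. -/
def BirkhoffOrth {X : Type*} [NormedAddCommGroup X] [NormedSpace ℝ X] (x y : X) : Prop :=
  ∀ t : ℝ, ‖x‖ ≤ ‖x + t • y‖

/-- `w = b(v)`: the unit vector `w` with `v ⊣ w` and `[v, w] > 0`. In a smooth normed plane there is
exactly one such `w` for each `v ≠ 0`. -/
structure IsBirkhoffTangent {X : Type*} [NormedAddCommGroup X] [NormedSpace ℝ X]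
    (Ω : LinearMap.BilinForm ℝ X) (v w : X) : Prop where
  norm_eq_one : ‖w‖ = 1
  orth : BirkhoffOrth v w
  pos : 0 < Ω v w

/-- `(γ, η) : S¹ → X × S` is a Legendre immersion. The circle is `ℝ / ℤ`, so that smooth maps on it
are smooth maps on `ℝ` of period `1`; `S` is the unit circle of the norm. A closed front is
a curve `γ` for which such an `η` exists. -/
structure IsClosedLegendreImmersion {X : Type*} [NormedAddCommGroup X] [NormedSpace ℝ X]
    (γ η : ℝ → X) : Prop where
  periodic_curve : Function.Periodic γ 1
  periodic_normal : Function.Periodic η 1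
  smooth_curve : ContDiff ℝ ∞ γ
  smooth_normal : ContDiff ℝ ∞ η
  norm_normal : ∀ t, ‖η t‖ = 1
  orth : ∀ t, BirkhoffOrth (η t) (deriv γ t)
  immersion : ∀ t, ¬ (deriv γ t = 0 ∧ deriv η t = 0)

/-- `(α, κ)` is the curvature pair of `(γ, η)`: `γ' = α ξ` and `η' = κ ξ`, where `ξ = b(η)`. -/
def IsCurvaturePair {X : Type*} [NormedAddCommGroup X] [NormedSpace ℝ X]
    (Ω : LinearMap.BilinForm ℝ X) (γ η : ℝ → X) (α κ : ℝ → ℝ) : Prop :=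
  ∀ t, ∃ ξ : X, IsBirkhoffTangent Ω (η t) ξ ∧ deriv γ t = α t • ξ ∧ deriv η t = κ t • ξ

/-- A singular point of `γ` at which `γ''` and `γ'''` are linearly independent. -/
def IsOrdinaryCusp {X : Type*} [NormedAddCommGroup X] [NormedSpace ℝ X]
    (γ : ℝ → X) (t : ℝ) : Prop :=
  deriv γ t = 0 ∧ LinearIndependent ℝ ![iteratedDeriv 2 γ t, iteratedDeriv 3 γ t]

/-- All singular points are ordinary cusps, and all self-intersections are double points:
the normals at two distinct parameters (of `ℝ / ℤ`) with the same image are independent. -/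
structure IsGeneric {X : Type*} [NormedAddCommGroup X] [NormedSpace ℝ X]
    (γ η : ℝ → X) : Prop where
  cusps : ∀ t, deriv γ t = 0 → IsOrdinaryCusp γ t
  double_points : ∀ s ∈ Set.Ico (0 : ℝ) 1, ∀ t ∈ Set.Ico (0 : ℝ) 1, s ≠ t → γ s = γ t →
    LinearIndependent ℝ ![η s, η t]

/-- The free product `ℤ₂ * ℤ₂`. -/
abbrev FreeProductZ2 : Type :=
  Monoid.Coprod (Multiplicative (ZMod 2)) (Multiplicative (ZMod 2))

/-- The generator `a` of `ℤ₂ * ℤ₂`, the letter of a zig. -/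
def letterA : FreeProductZ2 := Monoid.Coprod.inl (Multiplicative.ofAdd 1)

/-- The generator `b` of `ℤ₂ * ℤ₂`, the letter of a zag. -/
def letterB : FreeProductZ2 := Monoid.Coprod.inr (Multiplicative.ofAdd 1)

open Classical in
/-- The letter of an ordinary cusp: `a` for a zig, `[η, η'] > 0`, and `b` for a zag, `[η, η'] < 0`
(at an ordinary cusp of a front `[η, η']` is never zero). -/
def cuspLetter {X : Type*} [NormedAddCommGroup X] [NormedSpace ℝ X]
    (Ω : LinearMap.BilinForm ℝ X) (η : ℝ → X) (t : ℝ) : FreeProductZ2 :=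
  if 0 < Ω (η t) (deriv η t) then letterA else letterB

/-- `k` is the zigzag number: the word formed by the letters of the ordinary cusps
`t₁ < ... < tₘ` in `[0, 1)` equals `(ab)ᵏ` or `(ba)ᵏ` in `ℤ₂ * ℤ₂`. -/
def IsZigzagNumber {X : Type*} [NormedAddCommGroup X] [NormedSpace ℝ X]
    (Ω : LinearMap.BilinForm ℝ X) (γ η : ℝ → X) (k : ℕ) : Prop :=
  ∃ l : List ℝ, l.Pairwise (· < ·) ∧
    (∀ t, t ∈ l ↔ t ∈ Set.Ico (0 : ℝ) 1 ∧ IsOrdinaryCusp γ t) ∧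
    ((l.map (cuspLetter Ω η)).prod = (letterA * letterB) ^ k ∨
      (l.map (cuspLetter Ω η)).prod = (letterB * letterA) ^ k)

theorem cos_sin_ne_zero (θ : ℝ) : ((Real.cos θ, Real.sin θ) : ℝ × ℝ) ≠ 0 := by
  intro h
  have h1 : Real.cos θ = 0 := congrArg Prod.fst h
  have h2 : Real.sin θ = 0 := congrArg Prod.snd h
  have h3 := Real.sin_sq_add_cos_sq θ
  rw [h1, h2] at h3
  norm_num at h3

/-- The point `[cos θ : sin θ]` of the real projective line. -/
def lineAtAngle (θ : ℝ) : Projectivization ℝ (ℝ × ℝ) :=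
  Projectivization.mk ℝ (Real.cos θ, Real.sin θ) (cos_sin_ne_zero θ)

/-- `θ` is a continuous choice, over one period, of the angle of the line `k t`. -/
structure IsAngleLift (k : ℝ → Projectivization ℝ (ℝ × ℝ)) (θ : ℝ → ℝ) : Prop where
  continuousOn : ContinuousOn θ (Set.Icc 0 1)
  lift : ∀ t ∈ Set.Icc (0 : ℝ) 1, k t = lineAtAngle (θ t)

/-- `d` is the degree of the closed curve `k : ℝ / ℤ → P¹(ℝ)`. The angle of a line is determined
modulo `π`, so that running once through `P¹(ℝ)` changes the angle by `π`. -/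
def IsDegree (k : ℝ → Projectivization ℝ (ℝ × ℝ)) (d : ℤ) : Prop :=
  (∃ θ, IsAngleLift k θ) ∧ ∀ θ, IsAngleLift k θ → θ 1 - θ 0 = d * Real.pi

/-- `r` is the rotation number of `k : ℝ / ℤ → P¹(ℝ)`: the absolute value of the number of complete
turns (through the angle `2π`, counted with sign) of the line `k t` about the origin, that is, half
the absolute value of the degree of `k`. -/
def IsRotationNumber (k : ℝ → Projectivization ℝ (ℝ × ℝ)) (r : ℕ) : Prop :=
  ∃ d : ℤ, IsDegree k d ∧ |d| = 2 * (r : ℤ)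

theorem IsCurvaturePair.ne_zero {X : Type*} [NormedAddCommGroup X] [NormedSpace ℝ X]
    {Ω : LinearMap.BilinForm ℝ X} {γ η : ℝ → X} {α κ : ℝ → ℝ}
    (h : IsCurvaturePair Ω γ η α κ) (hγ : IsClosedLegendreImmersion γ η) (t : ℝ) :
    ((α t, κ t) : ℝ × ℝ) ≠ 0 := by
  intro h0
  have h1 : α t = 0 := congrArg Prod.fst h0
  have h2 : κ t = 0 := congrArg Prod.snd h0
  obtain ⟨ξ, -, ha, hk⟩ := h t
  exact hγ.immersion t ⟨by rw [ha, h1, zero_smul], by rw [hk, h2, zero_smul]⟩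

/-- The map `k_γ = [α : κ]` into the real projective line. -/
def curvatureMap {X : Type*} [NormedAddCommGroup X] [NormedSpace ℝ X]
    {Ω : LinearMap.BilinForm ℝ X} {γ η : ℝ → X} {α κ : ℝ → ℝ}
    (hγ : IsClosedLegendreImmersion γ η) (h : IsCurvaturePair Ω γ η α κ) :
    ℝ → Projectivization ℝ (ℝ × ℝ) :=
  fun t => Projectivization.mk ℝ (α t, κ t) (h.ne_zero hγ t)

end NormedPlane

end

/-! Put `A = Ω(η, γ')` and `K = Ω(η, η')`. The pair `(A, K)` is a positive multiple of `(α, κ)`, so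
it spans the line `k_γ`; it is moreover a smooth closed curve in the plane minus the origin, and has
a differentiable angle `θ` (`exists_angle`). Over one period `θ` grows by `2πd`, so the degree of
`k_γ` is `2d`.

The cusps are the zeros of `A`, that is, of `cos θ`, and the letter of a cusp is the sign of `sin
θ`. At a cusp `A' = Ω(η, γ'')`, which is nonzero because `γ''` is Birkhoff orthogonal to `η` as a
limit of difference quotients of `γ'`. Hence `θ` crosses `π/2 + kπ` with nonzero speed.

The Cayley graph of `ℤ₂ * ℤ₂` is a line. Number its vertices by `walk` and the strips `|φ - nπ| <
π/2` by `n`: passing between neighbouring strips, in either direction, is right multiplication by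
the letter of the crossing. The word of a path from strip `n` to strip `m` is thus `(walk n)⁻¹ *
walk m` (`prod_crossingLetter`), and `m = n + 2d` makes it `(ab)^|d|` or `(ba)^|d|`. -/

namespace NormedPlane

/-! ### Birkhoff orthogonality and the alternating form. -/

section Plane

variable {X : Type*} [NormedAddCommGroup X] [NormedSpace ℝ X]

theorem exists_smul_of_apply_eq_zero (hdim : Module.finrank ℝ X = 2)
    {Ω : LinearMap.BilinForm ℝ X} (hΩ : Ω.IsAlt) (hΩnd : Ω.Nondegenerate) {x v : X}
    (hx : x ≠ 0) (hv : Ω x v = 0) : ∃ c : ℝ, v = c • x := by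
  by_contra! hc
  have hli : LinearIndependent ℝ ![x, v] :=
    (LinearIndependent.pair_iff' hx).2 fun a ha => hc a ha.symm
  let b := basisOfLinearIndependentOfCardEqFinrank hli (by simp [hdim])
  apply hx
  apply hΩnd.1
  intro y
  have : Ω x = 0 := by
    apply b.ext
    intro i
    fin_cases i
    · simp [b, hΩ.self_eq_zero]
    · simp [b, hv]
  rw [this]; rfl

theorem BirkhoffOrth.apply_ne_zero (hdim : Module.finrank ℝ X = 2)
    {Ω : LinearMap.BilinForm ℝ X} (hΩ : Ω.IsAlt) (hΩnd : Ω.Nondegenerate) {x v : X}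
    (hx : x ≠ 0) (hv : v ≠ 0) (h : BirkhoffOrth x v) : Ω x v ≠ 0 := by
  intro h0
  obtain ⟨c, rfl⟩ := exists_smul_of_apply_eq_zero hdim hΩ hΩnd hx h0
  have hc : c ≠ 0 := by rintro rfl; simp at hv
  have := h (-c⁻¹)
  rw [smul_smul, neg_mul, inv_mul_cancel₀ hc, neg_one_smul, add_neg_cancel, norm_zero] at this
  exact hx (norm_le_zero_iff.1 this)

theorem BirkhoffOrth.smul_right {x v : X} (h : BirkhoffOrth x v) (c : ℝ) :
    BirkhoffOrth x (c • v) := fun t => by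
  rw [smul_smul]; exact h _

/-- A functional of norm at most one that norms `x` has a nontrivial kernel, and it bounds `‖x + t •
w‖` below by `‖x‖` for `w` in that kernel. Scaling fixes length and sign. -/
theorem exists_isBirkhoffTangent (hdim : Module.finrank ℝ X = 2)
    {Ω : LinearMap.BilinForm ℝ X} (hΩ : Ω.IsAlt) (hΩnd : Ω.Nondegenerate) {x : X}
    (hx : x ≠ 0) : ∃ w, IsBirkhoffTangent Ω x w := by
  have : FiniteDimensional ℝ X := Module.finite_of_finrank_pos (by omega)
  obtain ⟨f, hf, hfx⟩ := exists_dual_vector'' ℝ x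
  have hker : (f : X →ₗ[ℝ] ℝ).ker ≠ ⊥ :=
    LinearMap.ker_ne_bot_of_finrank_lt (by simp [hdim])
  obtain ⟨w, hw, hw0⟩ := Submodule.exists_mem_ne_zero_of_ne_bot hker
  have hfw : f w = 0 := hw
  have horth : BirkhoffOrth x w := fun t => by
    have h1 : f (x + t • w) = ‖x‖ := by simp [hfw, hfx]
    calc ‖x‖ = f (x + t • w) := h1.symm
      _ ≤ ‖f (x + t • w)‖ := le_abs_self _
      _ ≤ ‖f‖ * ‖x + t • w‖ := f.le_opNorm _
      _ ≤ 1 * ‖x + t • w‖ := by gcongr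
      _ = _ := one_mul _
  have hne := horth.apply_ne_zero hdim hΩ hΩnd hx hw0
  have hnw : 0 < ‖w‖ := norm_pos_iff.2 hw0
  rcases lt_or_gt_of_ne hne with h | h
  · refine ⟨(-‖w‖⁻¹) • w, ?_, horth.smul_right _, ?_⟩
    · rw [norm_smul, norm_neg, norm_inv, norm_norm, inv_mul_cancel₀ hnw.ne']
    · rw [map_smul, smul_eq_mul, neg_mul, neg_pos]
      exact mul_neg_of_pos_of_neg (inv_pos.2 hnw) h
  · refine ⟨‖w‖⁻¹ • w, ?_, horth.smul_right _, ?_⟩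
    · rw [norm_smul, norm_inv, norm_norm, inv_mul_cancel₀ hnw.ne']
    · rw [map_smul, smul_eq_mul]
      exact mul_pos (inv_pos.2 hnw) h

theorem BirkhoffOrth.fderiv_norm_eq_zero {x v : X}
    (hd : DifferentiableAt ℝ (fun y : X => ‖y‖) x) (h : BirkhoffOrth x v) :
    fderiv ℝ (fun y : X => ‖y‖) x v = 0 := by
  have hl : HasDerivAt (fun t : ℝ => x + t • v) v 0 := by
    simpa using ((hasDerivAt_id (0 : ℝ)).smul_const v).const_add x
  have hc : HasDerivAt (fun t : ℝ => ‖x + t • v‖) (fderiv ℝ (fun y : X => ‖y‖) x v) 0 :=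
    HasFDerivAt.comp_hasDerivAt (f := fun t : ℝ => x + t • v) (l := fun y : X => ‖y‖) 0
      (by simpa using hd.hasFDerivAt) hl
  exact IsLocalMin.hasDerivAt_eq_zero (Filter.Eventually.of_forall fun t => by simpa using h t) hc

theorem exists_smul_of_fderiv_norm_eq_zero (hdim : Module.finrank ℝ X = 2)
    {Ω : LinearMap.BilinForm ℝ X} (hΩ : Ω.IsAlt) (hΩnd : Ω.Nondegenerate) {x v w : X}
    (hx : x ≠ 0) (hd : DifferentiableAt ℝ (fun y : X => ‖y‖) x) (hw : IsBirkhoffTangent Ω x w)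
    (hv : fderiv ℝ (fun y : X => ‖y‖) x v = 0) : ∃ q : ℝ, v = q • w := by
  have hw0 := hw.orth.fderiv_norm_eq_zero hd
  -- Without its `w`-component `v` is a multiple of `x`; the derivative of the norm kills it but
  -- equals `‖x‖` at `x`, so the multiple is zero.
  obtain ⟨c, hc⟩ := exists_smul_of_apply_eq_zero (v := v - (Ω x v / Ω x w) • w) hdim hΩ hΩnd hx
    (by rw [map_sub, map_smul, smul_eq_mul, div_mul_cancel₀ _ hw.pos.ne', sub_self])
  have h1 := congrArg (fderiv ℝ (fun y : X => ‖y‖) x) hc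
  rw [map_sub, map_smul, map_smul, hv, hw0, hd.fderiv_norm_self] at h1
  have hc0 : c = 0 := by
    have : c * ‖x‖ = 0 := by simpa using h1.symm
    exact (mul_eq_zero.1 this).resolve_right (norm_ne_zero_iff.2 hx)
  rw [hc0, zero_smul, sub_eq_zero] at hc
  exact ⟨_, hc⟩

variable {γ η : ℝ → X}

theorem IsClosedLegendreImmersion.normal_ne_zero (hγ : IsClosedLegendreImmersion γ η) (t : ℝ) :
    η t ≠ 0 := norm_ne_zero_iff.1 (by rw [hγ.norm_normal]; exact one_ne_zero)

theorem IsClosedLegendreImmersion.exists_curvaturePair (hdim : Module.finrank ℝ X = 2)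
    (hsmooth : ∀ x : X, x ≠ 0 → DifferentiableAt ℝ (fun y : X => ‖y‖) x)
    {Ω : LinearMap.BilinForm ℝ X} (hΩ : Ω.IsAlt) (hΩnd : Ω.Nondegenerate)
    (hγ : IsClosedLegendreImmersion γ η) : ∃ α κ : ℝ → ℝ, IsCurvaturePair Ω γ η α κ := by
  choose ξ hξ using fun t => exists_isBirkhoffTangent hdim hΩ hΩnd (hγ.normal_ne_zero t)
  have hd := fun t => hsmooth _ (hγ.normal_ne_zero t)
  choose α hα using fun t => exists_smul_of_fderiv_norm_eq_zero hdim hΩ hΩnd (hγ.normal_ne_zero t)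
    (hd t) (hξ t) ((hγ.orth t).fderiv_norm_eq_zero (hd t))
  have hη : ∀ t, fderiv ℝ (fun y : X => ‖y‖) (η t) (deriv η t) = 0 := fun t => by
    have h1 := (hd t).hasFDerivAt.comp_hasDerivAt t
      (hγ.smooth_normal.differentiable (by simp) t).hasDerivAt
    have h2 : HasDerivAt ((fun y : X => ‖y‖) ∘ η) 0 t := by
      have : (fun y : X => ‖y‖) ∘ η = fun _ => 1 := funext hγ.norm_normal
      rw [this]; exact hasDerivAt_const _ _
    exact h1.unique h2
  choose κ hκ using fun t => exists_smul_of_fderiv_norm_eq_zero hdim hΩ hΩnd (hγ.normal_ne_zero t)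
    (hd t) (hξ t) (hη t)
  exact ⟨α, κ, fun t => ⟨ξ t, hξ t, hα t, hκ t⟩⟩

/-- As `ζ t = 0`, the slopes are multiples of `ζ u`, hence orthogonal to `η u`; the defining
inequalities survive the limit. -/
theorem birkhoffOrth_deriv_of_eq_zero {η ζ : ℝ → X} {t : ℝ} {v : X} (hη : ContinuousAt η t)
    (h : ∀ u, BirkhoffOrth (η u) (ζ u)) (h0 : ζ t = 0) (hζ : HasDerivAt ζ v t) :
    BirkhoffOrth (η t) v := fun s => by
  have h1 := hasDerivAt_iff_tendsto_slope.1 hζ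
  have h2 := hη.tendsto.mono_left (nhdsWithin_le_nhds (s := {t}ᶜ))
  refine le_of_tendsto_of_tendsto' h2.norm (h2.add (h1.const_smul s)).norm fun u => ?_
  have := (h u).smul_right (u - t)⁻¹ s
  simpa [slope_def_module, h0] using this

end Plane

/-! ### The free product as a line. -/

/-- The elements of `ℤ₂ * ℤ₂` as the vertices of a line: `walk (2k) = (ab)ᵏ` and
`walk (2k + 1) = (ab)ᵏa`. -/
noncomputable def walk (n : ℤ) : FreeProductZ2 :=
  (letterA * letterB) ^ (n / 2) * if Even n then 1 else letterA

theorem letterA_mul_self : letterA * letterA = 1 := by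
  rw [letterA, ← map_mul, show Multiplicative.ofAdd (1 : ZMod 2) * Multiplicative.ofAdd 1 = 1 from
    rfl, map_one]

theorem letterB_mul_self : letterB * letterB = 1 := by
  rw [letterB, ← map_mul, show Multiplicative.ofAdd (1 : ZMod 2) * Multiplicative.ofAdd 1 = 1 from
    rfl, map_one]

theorem walk_even (k : ℤ) : walk (2 * k) = (letterA * letterB) ^ k := by
  simp [walk]

theorem walk_odd (k : ℤ) : walk (2 * k + 1) = (letterA * letterB) ^ k * letterA := by
  have : (2 * k + 1) / 2 = k := by omega
  simp [walk, this]

theorem walk_add_one (n : ℤ) :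
    walk (n + 1) = walk n * if Even n then letterA else letterB := by
  obtain ⟨k, rfl | rfl⟩ := Int.even_or_odd' n
  · simp [walk_odd, walk_even]
  · rw [show 2 * k + 1 + 1 = 2 * (k + 1) by ring, walk_even, walk_odd, zpow_add_one]
    simp [mul_assoc]

theorem walk_eq_walk_add_one_mul (n : ℤ) :
    walk n = walk (n + 1) * if Even n then letterA else letterB := by
  rw [walk_add_one]
  split_ifs <;> simp [mul_assoc, letterA_mul_self, letterB_mul_self]

theorem inv_letterA_mul_letterB : (letterA * letterB)⁻¹ = letterB * letterA := by
  rw [mul_inv_rev, inv_eq_of_mul_eq_one_left letterA_mul_self,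
    inv_eq_of_mul_eq_one_left letterB_mul_self]

theorem zpow_letters_eq_pow (d : ℤ) :
    (letterA * letterB) ^ d = (letterA * letterB) ^ d.natAbs ∨
      (letterA * letterB) ^ d = (letterB * letterA) ^ d.natAbs := by
  rcases Int.natAbs_eq d with h | h
  · left; conv_lhs => rw [h]
    rw [zpow_natCast]
  · right; conv_lhs => rw [h]
    rw [zpow_neg, ← inv_zpow, inv_letterA_mul_letterB, zpow_natCast]

theorem inv_walk_mul_walk_add (n d : ℤ) :
    (walk n)⁻¹ * walk (n + 2 * d) = (letterA * letterB) ^ d.natAbs ∨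
      (walk n)⁻¹ * walk (n + 2 * d) = (letterB * letterA) ^ d.natAbs := by
  obtain ⟨k, rfl | rfl⟩ := Int.even_or_odd' n
  · rw [← mul_add, walk_even, walk_even, ← zpow_neg, ← zpow_add, neg_add_cancel_left]
    exact zpow_letters_eq_pow d
  · rw [show 2 * k + 1 + 2 * d = 2 * (k + d) + 1 by ring, walk_odd, walk_odd]
    have h : ((letterA * letterB) ^ k * letterA)⁻¹ * ((letterA * letterB) ^ (k + d) * letterA)
        = (letterA * letterB) ^ (-d) := by
      -- Conjugation by `a` turns `ab` into `ba`, its inverse; an odd starting vertex therefore only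
      -- reverses the sign of `d`.
      have h1 : (letterA * letterB) ^ (-d) = letterA⁻¹ * (letterA * letterB) ^ d * letterA := by
        have := conj_zpow (a := letterA⁻¹) (b := letterA * letterB) (i := d)
        rw [inv_inv] at this
        rw [← this, zpow_neg, ← inv_zpow, inv_letterA_mul_letterB]
        simp
      rw [h1, zpow_add]; group
    rw [h]
    simpa using zpow_letters_eq_pow (-d)

end NormedPlane

/-! ### Crossings of the vertical axis by an angle function. -/

namespace NormedPlane

open Filter Topology Real

open Classical in
/-- The letter of a crossing of the vertical axis at the angle `φ`. -/
noncomputable def crossingLetter (φ : ℝ) : FreeProductZ2 :=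
  if 0 < sin φ then letterA else letterB

theorem crossingLetter_eq (k : ℤ) :
    crossingLetter (π / 2 + k * π) = if Even k then letterA else letterB := by
  have h : sin (π / 2 + k * π) = (-1) ^ k := by
    rw [sin_add_int_mul_pi, sin_pi_div_two, mul_one]
  rw [crossingLetter, h]
  split_ifs with h1 h2 h2
  · rfl
  · rw [(Int.not_even_iff_odd.1 h2).neg_one_zpow] at h1; norm_num at h1
  · rw [h2.neg_one_zpow] at h1; norm_num at h1
  · rfl

theorem exists_eq_of_cos_eq_zero {φ : ℝ} (h : cos φ = 0) : ∃ k : ℤ, φ = π / 2 + k * π := by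
  obtain ⟨k, hk⟩ := cos_eq_zero_iff.1 h
  exact ⟨k, by rw [hk]; ring⟩

theorem cos_ne_zero_of_abs_sub_lt {φ : ℝ} {n : ℤ} (h : |φ - n * π| < π / 2) : cos φ ≠ 0 := by
  intro h0
  have h1 : 0 < cos (φ - n * π) := cos_pos_of_mem_Ioo (abs_lt.1 h)
  rw [cos_sub_int_mul_pi, h0, mul_zero] at h1
  exact lt_irrefl _ h1

theorem exists_abs_sub_lt_of_cos_ne_zero {φ : ℝ} (h : cos φ ≠ 0) :
    ∃ n : ℤ, |φ - n * π| < π / 2 := by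
  refine ⟨⌊φ / π + 1 / 2⌋, ?_⟩
  have hπ := pi_pos
  have h1 := Int.floor_le (φ / π + 1 / 2)
  have h2 := Int.lt_floor_add_one (φ / π + 1 / 2)
  set n := ⌊φ / π + 1 / 2⌋
  have e : φ / π * π = φ := div_mul_cancel₀ _ hπ.ne'
  have h3 : (n : ℝ) * π ≤ φ + π / 2 := by nlinarith
  have h4 : φ + π / 2 < n * π + π := by nlinarith
  rw [abs_lt]
  refine ⟨lt_of_le_of_ne (by linarith) ?_, by linarith⟩
  intro h5
  apply h
  rw [show φ = -(π / 2) + n * π by linarith, cos_add_int_mul_pi]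
  simp

theorem eq_of_abs_sub_lt {φ : ℝ} {n m : ℤ} (hn : |φ - n * π| < π / 2)
    (hm : |φ - m * π| < π / 2) : n = m := by
  have hπ := pi_pos
  rw [abs_lt] at hn hm
  have h1 : ((n : ℝ) - m) * π < 1 * π := by linarith
  have h2 : (-1) * π < ((n : ℝ) - m) * π := by linarith
  have h3 := lt_of_mul_lt_mul_right h1 hπ.le
  have h4 := lt_of_mul_lt_mul_right h2 hπ.le
  have h5 : n - m < 1 := by exact_mod_cast h3
  have h6 : -1 < n - m := by exact_mod_cast h4
  omega

theorem abs_sub_lt_of_forall_cos_ne_zero {θ : ℝ → ℝ} (hθ : Continuous θ) {s e : ℝ} (hse : s ≤ e)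
    {n : ℤ} (hs : |θ s - n * π| < π / 2) (hne : ∀ t ∈ Set.Icc s e, cos (θ t) ≠ 0) :
    |θ e - n * π| < π / 2 := by
  rw [abs_lt] at hs ⊢
  constructor
  · by_contra! h
    obtain ⟨t, ht, hte⟩ := intermediate_value_Icc' hse hθ.continuousOn
      (show -(π / 2) + n * π ∈ Set.Icc (θ e) (θ s) from ⟨by linarith, by linarith⟩)
    exact hne t ht (by rw [hte, cos_add_int_mul_pi]; simp)
  · by_contra! h
    obtain ⟨t, ht, hte⟩ := intermediate_value_Icc hse hθ.continuousOn
      (show π / 2 + n * π ∈ Set.Icc (θ s) (θ e) from ⟨by linarith, by linarith⟩)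
    exact hne t ht (by rw [hte, cos_add_int_mul_pi]; simp)

/-- The sign of the slope tells on which side of `π/2 + kπ` the angle lies before and after `t`, and
staying within `π` of it confines the angle to strips `k` and `k + 1`. -/
theorem exists_crossing {θ : ℝ → ℝ} {t c : ℝ} (hθ : HasDerivAt θ c t) (hc : c ≠ 0)
    (h0 : cos (θ t) = 0) : ∃ δ > 0, ∃ p q : ℤ,
      (∀ u ∈ Set.Ioo (t - δ) t, |θ u - p * π| < π / 2) ∧
      (∀ u ∈ Set.Ioo t (t + δ), |θ u - q * π| < π / 2) ∧
      walk q = walk p * crossingLetter (θ t) := by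
  obtain ⟨k, hk⟩ := exists_eq_of_cos_eq_zero h0
  have hslope := hasDerivAt_iff_tendsto_slope.1 hθ
  have hnear : ∀ᶠ u in 𝓝[≠] t, |θ u - θ t| < π :=
    (hθ.continuousAt.eventually (Metric.ball_mem_nhds _ pi_pos)).filter_mono nhdsWithin_le_nhds
  rcases lt_or_gt_of_ne hc with hc | hc
  · obtain ⟨δ, hδ, H⟩ := Metric.eventually_nhds_iff.1 (eventually_nhdsWithin_iff.1
      ((hslope.eventually (gt_mem_nhds hc)).and hnear))
    refine ⟨δ, hδ, k + 1, k, fun u hu => ?_, fun u hu => ?_, ?_⟩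
    · obtain ⟨h1, h2⟩ := H (by rw [Real.dist_eq, abs_lt]; constructor <;> linarith [hu.1, hu.2])
        hu.2.ne
      rw [slope_def_field, div_neg_iff] at h1
      rw [hk] at h1 h2
      rw [abs_lt] at h2 ⊢
      push_cast
      constructor <;> rcases h1 with h1 | h1 <;> linarith [hu.1, hu.2]
    · obtain ⟨h1, h2⟩ := H (by rw [Real.dist_eq, abs_lt]; constructor <;> linarith [hu.1, hu.2])
        hu.1.ne'
      rw [slope_def_field, div_neg_iff] at h1
      rw [hk] at h1 h2
      rw [abs_lt] at h2 ⊢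
      constructor <;> rcases h1 with h1 | h1 <;> linarith [hu.1, hu.2]
    · rw [hk, crossingLetter_eq]; exact walk_eq_walk_add_one_mul k
  · obtain ⟨δ, hδ, H⟩ := Metric.eventually_nhds_iff.1 (eventually_nhdsWithin_iff.1
      ((hslope.eventually (lt_mem_nhds hc)).and hnear))
    refine ⟨δ, hδ, k, k + 1, fun u hu => ?_, fun u hu => ?_, ?_⟩
    · obtain ⟨h1, h2⟩ := H (by rw [Real.dist_eq, abs_lt]; constructor <;> linarith [hu.1, hu.2])
        hu.2.ne
      rw [slope_def_field, div_pos_iff] at h1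
      rw [hk] at h1 h2
      rw [abs_lt] at h2 ⊢
      constructor <;> rcases h1 with h1 | h1 <;> linarith [hu.1, hu.2]
    · obtain ⟨h1, h2⟩ := H (by rw [Real.dist_eq, abs_lt]; constructor <;> linarith [hu.1, hu.2])
        hu.1.ne'
      rw [slope_def_field, div_pos_iff] at h1
      rw [hk] at h1 h2
      rw [abs_lt] at h2 ⊢
      push_cast
      constructor <;> rcases h1 with h1 | h1 <;> linarith [hu.1, hu.2]
    · rw [hk, crossingLetter_eq]; exact walk_add_one k

/-- Induction along the list: the path stays in strip `n` up to the first crossing, and the tail is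
treated from a point just after it. The endpoints are free so that the left one can move. -/
theorem prod_crossingLetter {θ : ℝ → ℝ} (hθ : Continuous θ)
    (hd : ∀ t, cos (θ t) = 0 → ∃ c ≠ 0, HasDerivAt θ c t) (l : List ℝ) :
    ∀ (s e : ℝ) (n m : ℤ), s ≤ e → |θ s - n * π| < π / 2 → |θ e - m * π| < π / 2 →
      l.Pairwise (· < ·) → (∀ t, t ∈ l ↔ t ∈ Set.Icc s e ∧ cos (θ t) = 0) →
      (l.map fun t => crossingLetter (θ t)).prod = (walk n)⁻¹ * walk m := by
  induction l with
  | nil =>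
    intro s e n m hse hs he _ hl
    have := abs_sub_lt_of_forall_cos_ne_zero hθ hse hs fun t ht h0 =>
      List.not_mem_nil ((hl t).2 ⟨ht, h0⟩)
    simp [eq_of_abs_sub_lt this he]
  | cons t l ih =>
    intro s e n m hse hs he hlt hl
    rw [List.pairwise_cons] at hlt
    obtain ⟨⟨hst, hte⟩, ht0⟩ := (hl t).1 List.mem_cons_self
    have hst' : s < t := lt_of_le_of_ne hst fun h => cos_ne_zero_of_abs_sub_lt hs (h ▸ ht0)
    have hte' : t < e := lt_of_le_of_ne hte fun h => cos_ne_zero_of_abs_sub_lt he (h ▸ ht0)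
    obtain ⟨c, hc, hdt⟩ := hd t ht0
    obtain ⟨δ, hδ, p, q, hp, hq, hpq⟩ := exists_crossing hdt hc ht0
    have hbefore : ∀ u ∈ Set.Icc s (max s (t - δ / 2)), cos (θ u) ≠ 0 := fun u hu h0 => by
      have hut : u < t := hu.2.trans_lt (max_lt hst' (by linarith))
      rcases List.mem_cons.1 ((hl u).2 ⟨⟨hu.1, by linarith⟩, h0⟩) with h | h
      · exact hut.ne h
      · exact (hlt.1 u h).not_gt hut
    have hnp : n = p := eq_of_abs_sub_lt
      (abs_sub_lt_of_forall_cos_ne_zero hθ (le_max_left _ _) hs hbefore)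
      (hp _ ⟨lt_max_of_lt_right (by linarith), max_lt hst' (by linarith)⟩)
    have hut : t < min e (t + δ / 2) := lt_min hte' (by linarith)
    have hq' : ∀ u ∈ Set.Ioc t (min e (t + δ / 2)), |θ u - q * π| < π / 2 := fun u hu =>
      hq u ⟨hu.1, by linarith [hu.2.trans (min_le_right e (t + δ / 2))]⟩
    have := ih (min e (t + δ / 2)) e q m (min_le_left _ _) (hq' _ ⟨hut, le_rfl⟩) he hlt.2
      fun u => by
        constructor
        · intro hu
          obtain ⟨⟨_, h2⟩, h0⟩ := (hl u).1 (List.mem_cons_of_mem _ hu)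
          refine ⟨⟨?_, h2⟩, h0⟩
          by_contra! h
          exact cos_ne_zero_of_abs_sub_lt (hq' u ⟨hlt.1 u hu, h.le⟩) h0
        · rintro ⟨⟨h1, h2⟩, h0⟩
          rcases List.mem_cons.1 ((hl u).2 ⟨⟨by linarith, h2⟩, h0⟩) with h | h
          · linarith
          · exact h
    rw [List.map_cons, List.prod_cons, this, hpq, hnp]
    have hsq : crossingLetter (θ t) * crossingLetter (θ t) = 1 := by
      rw [crossingLetter]; split_ifs
      exacts [letterA_mul_self, letterB_mul_self]
    rw [mul_inv_rev, inv_eq_of_mul_eq_one_left hsq, ← mul_assoc, ← mul_assoc, hsq, one_mul]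

theorem eq_of_forall_eq_intCast {f : ℝ → ℝ} {a b : ℝ} (hab : a ≤ b)
    (hf : ContinuousOn f (Set.Icc a b)) (hn : ∀ t ∈ Set.Icc a b, ∃ n : ℤ, f t = n) :
    f b = f a := by
  have : DiscreteTopology (Set.range ((↑) : ℤ → ℝ)) :=
    (Int.isClosedEmbedding_coe_real.isEmbedding.toHomeomorph).symm.isEmbedding.discreteTopology
  exact isPreconnected_Icc.constant_of_mapsTo (T := Set.range ((↑) : ℤ → ℝ))
    (isDiscrete_iff_discreteTopology.2 this) hf
    (fun t ht => (hn t ht).imp fun _ h => h.symm) (Set.right_mem_Icc.2 hab) (Set.left_mem_Icc.2 hab)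

/-! ### Angle lifts and finiteness of crossings. -/

/-- With `F = A + iK`, the integral `G` of `F'/F` is a logarithm of `F / F 0`; its imaginary part is
the angle up to a constant. -/
theorem exists_angle {A K A' K' : ℝ → ℝ} (hA : ∀ t, HasDerivAt A (A' t) t)
    (hK : ∀ t, HasDerivAt K (K' t) t) (hA' : Continuous A') (hK' : Continuous K')
    (hne : ∀ t, (A t, K t) ≠ 0) :
    ∃ θ r : ℝ → ℝ, (∀ t, 0 < r t) ∧ (∀ t, A t = r t * cos (θ t)) ∧ (∀ t, K t = r t * sin (θ t)) ∧
      ∀ t, HasDerivAt θ ((A t * K' t - K t * A' t) / (A t ^ 2 + K t ^ 2)) t := by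
  let F : ℝ → ℂ := fun t => A t + K t * Complex.I
  let F' : ℝ → ℂ := fun t => A' t + K' t * Complex.I
  have hF : ∀ t, HasDerivAt F (F' t) t := fun t =>
    (hA t).ofReal_comp.add ((hK t).ofReal_comp.mul_const Complex.I)
  have hF0 : ∀ t, F t ≠ 0 := fun t h => hne t <| by
    have h1 := congrArg Complex.re h
    have h2 := congrArg Complex.im h
    simp only [F, Complex.add_re, Complex.add_im, Complex.ofReal_re, Complex.ofReal_im,
      Complex.re_ofReal_mul, Complex.im_ofReal_mul, Complex.I_re, Complex.I_im, Complex.zero_re,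
      Complex.zero_im, mul_zero, mul_one, add_zero, zero_add] at h1 h2
    rw [h1, h2]; rfl
  have hFc : Continuous F := continuous_iff_continuousAt.2 fun t => (hF t).continuousAt
  have hFc' : Continuous F' := by fun_prop
  have hq : Continuous fun t => F' t / F t := hFc'.div hFc hF0
  let G : ℝ → ℂ := fun t => ∫ u in (0 : ℝ)..t, F' u / F u
  have hG : ∀ t, HasDerivAt G (F' t / F t) t := fun t =>
    intervalIntegral.integral_hasDerivAt_right (hq.intervalIntegrable _ _)
      (hq.stronglyMeasurableAtFilter _ _) hq.continuousAt
  have hE : ∀ t, HasDerivAt (fun u => F u * Complex.exp (-G u)) 0 t := fun t => by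
    have := (hF t).mul (hG t).neg.cexp
    refine this.congr_deriv ?_
    field_simp [hF0 t]
    ring
  have hconst : ∀ t, F t = F 0 * Complex.exp (G t) := fun t => by
    have h1 := is_const_of_deriv_eq_zero (fun u => (hE u).differentiableAt)
      (fun u => (hE u).deriv) t 0
    have h2 : G 0 = 0 := intervalIntegral.integral_same
    simp only [h2, neg_zero, Complex.exp_zero, mul_one] at h1
    rw [← h1, mul_assoc, ← Complex.exp_add, neg_add_cancel, Complex.exp_zero, mul_one]
  have hpolar : ∀ t, F t = ((‖F 0‖ * exp (G t).re : ℝ) : ℂ) *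
      Complex.exp (((Complex.arg (F 0) + (G t).im : ℝ) : ℂ) * Complex.I) := fun t => by
    conv_lhs => rw [hconst t, ← Complex.norm_mul_exp_arg_mul_I (F 0), ← Complex.re_add_im (G t)]
    push_cast
    rw [Complex.exp_add, add_mul, Complex.exp_add]
    ring
  refine ⟨fun t => Complex.arg (F 0) + (G t).im, fun t => ‖F 0‖ * exp (G t).re,
    fun t => mul_pos (norm_pos_iff.2 (hF0 0)) (exp_pos _), fun t => ?_, fun t => ?_, fun t => ?_⟩
  · have := congrArg Complex.re (hpolar t)
    rw [Complex.re_ofReal_mul, Complex.exp_ofReal_mul_I_re] at this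
    simpa [F] using this
  · have := congrArg Complex.im (hpolar t)
    rw [Complex.im_ofReal_mul, Complex.exp_ofReal_mul_I_im] at this
    simpa [F] using this
  · have him : HasDerivAt (fun u => (G u).im) (F' t / F t).im t :=
      Complex.imCLM.hasFDerivAt.comp_hasDerivAt t (hG t)
    refine (him.const_add _).congr_deriv ?_
    simp only [Complex.div_im, Complex.normSq_apply, F, F', Complex.add_re, Complex.add_im,
      Complex.ofReal_re, Complex.ofReal_im, Complex.re_ofReal_mul, Complex.im_ofReal_mul,
      Complex.I_re, Complex.I_im, mul_zero, mul_one, add_zero, zero_add]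
    rw [← sub_div]
    congr 1 <;> ring

theorem exists_eq_add_int_mul_pi {x y : ℝ} (h : lineAtAngle x = lineAtAngle y) :
    ∃ n : ℤ, x - y = n * π := by
  obtain ⟨c, hc⟩ := (Projectivization.mk_eq_mk_iff' ℝ _ _ _ _).1 h
  have h1 : c * cos y = cos x := congrArg Prod.fst hc
  have h2 : c * sin y = sin x := congrArg Prod.snd hc
  obtain ⟨n, hn⟩ := sin_eq_zero_iff.1 (show sin (x - y) = 0 by
    rw [sin_sub, ← h1, ← h2]; ring)
  exact ⟨n, hn.symm⟩

/-- Two lifts differ by a continuous function with values in `πℤ`, which is constant. -/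
theorem IsAngleLift.sub_eq {k : ℝ → Projectivization ℝ (ℝ × ℝ)} {θ φ : ℝ → ℝ}
    (hθ : IsAngleLift k θ) (hφ : IsAngleLift k φ) : θ 1 - θ 0 = φ 1 - φ 0 := by
  have := eq_of_forall_eq_intCast (f := fun t => (θ t - φ t) / π) zero_le_one
    ((hθ.continuousOn.sub hφ.continuousOn).div_const _) fun t ht => by
      obtain ⟨n, hn⟩ := exists_eq_add_int_mul_pi ((hθ.lift t ht).symm.trans (hφ.lift t ht))
      exact ⟨n, by rw [hn, mul_div_cancel_right₀ _ pi_ne_zero]⟩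
  have := (div_left_inj' pi_ne_zero).1 this
  linarith

theorem eventually_cos_ne_zero {θ : ℝ → ℝ} (hθ : Continuous θ)
    (hd : ∀ t, cos (θ t) = 0 → ∃ c ≠ 0, HasDerivAt θ c t) (t : ℝ) :
    ∀ᶠ u in 𝓝[≠] t, cos (θ u) ≠ 0 := by
  by_cases h0 : cos (θ t) = 0
  · obtain ⟨c, hc, hdt⟩ := hd t h0
    refine hdt.cos.eventually_ne (mul_ne_zero (neg_ne_zero.2 fun hs => ?_) hc)
    have := sin_sq_add_cos_sq (θ t)
    rw [hs, h0] at this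
    norm_num at this
  · exact ((continuous_cos.comp hθ).continuousAt.eventually_ne h0).filter_mono nhdsWithin_le_nhds

theorem finite_cos_eq_zero {θ : ℝ → ℝ} (hθ : Continuous θ)
    (hd : ∀ t, cos (θ t) = 0 → ∃ c ≠ 0, HasDerivAt θ c t) (a b : ℝ) :
    (Set.Icc a b ∩ {t | cos (θ t) = 0}).Finite := by
  have hclosed : IsClosed {t | cos (θ t) = 0} :=
    isClosed_eq (continuous_cos.comp hθ) continuous_const
  refine (isCompact_Icc.inter_right hclosed).finite (isDiscrete_iff_nhdsNE.2 fun t ht => ?_)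
  rw [inf_principal_eq_bot]
  filter_upwards [eventually_cos_ne_zero hθ hd t] with u hu hu'
  exact hu hu'.2

end NormedPlane

/-! ### The word of a closed curve around the origin. -/

namespace NormedPlane

open Filter Topology Real

/-- Equal vectors, unlike equal lines, fix the angle modulo `2π`; this is what makes the degree
even. -/
theorem exists_sub_eq_int_mul_two_pi {r s x y : ℝ} (hr : 0 < r) (hs : 0 < s)
    (hc : r * cos x = s * cos y) (hsin : r * sin x = s * sin y) : ∃ n : ℤ, x - y = n * (2 * π) := by
  have hrs : r = s := by
    refine (sq_eq_sq₀ hr.le hs.le).1 ?_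
    calc r ^ 2 = (r * cos x) ^ 2 + (r * sin x) ^ 2 := by
          rw [mul_pow, mul_pow, ← mul_add, cos_sq_add_sin_sq, mul_one]
      _ = s ^ 2 := by
          rw [hc, hsin, mul_pow, mul_pow, ← mul_add, cos_sq_add_sin_sq, mul_one]
  rw [hrs] at hc hsin
  have h1 := mul_left_cancel₀ hs.ne' hc
  have h2 := mul_left_cancel₀ hs.ne' hsin
  obtain ⟨n, hn⟩ := (cos_eq_one_iff (x - y)).1 (by
    rw [cos_sub, h1, h2, ← sq, ← sq, cos_sq_add_sin_sq])
  exact ⟨n, hn.symm⟩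

/-- The crossings of the vertical axis by a closed curve around the origin spell its winding
number. -/
theorem exists_list_crossings {θ : ℝ → ℝ} (hθ : Continuous θ)
    (hd : ∀ t, cos (θ t) = 0 → ∃ c ≠ 0, HasDerivAt θ c t)
    (hper : ∀ t, ∃ n : ℤ, θ (t + 1) - θ t = n * (2 * π)) :
    ∃ (d : ℤ) (l : List ℝ), θ 1 - θ 0 = (2 * d : ℤ) * π ∧ l.Pairwise (· < ·) ∧
      (∀ t, t ∈ l ↔ t ∈ Set.Ico (0 : ℝ) 1 ∧ cos (θ t) = 0) ∧
      ((l.map fun t => crossingLetter (θ t)).prod = (letterA * letterB) ^ d.natAbs ∨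
        (l.map fun t => crossingLetter (θ t)).prod = (letterB * letterA) ^ d.natAbs) := by
  have h2π : (2 * π) ≠ 0 := by positivity
  obtain ⟨d, hd0⟩ := hper 0
  rw [zero_add] at hd0
  have hshift : ∀ s ≤ 0, θ (s + 1) = θ s + (2 * d : ℤ) * π := fun s hs => by
    have := eq_of_forall_eq_intCast (f := fun t => (θ (t + 1) - θ t) / (2 * π)) hs
      (by fun_prop) fun t _ => by
        obtain ⟨n, hn⟩ := hper t
        exact ⟨n, by rw [hn, mul_div_cancel_right₀ _ h2π]⟩
    have := (div_left_inj' h2π).1 this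
    rw [zero_add, hd0] at this
    push_cast
    linarith
  have hcos : ∀ t, cos (θ (t + 1)) = cos (θ t) := fun t => by
    obtain ⟨n, hn⟩ := hper t
    rw [sub_eq_iff_eq_add'.1 hn, cos_add_int_mul_two_pi]
  obtain ⟨ε, hε, H⟩ := Metric.eventually_nhds_iff.1
    (eventually_nhdsWithin_iff.1 (eventually_cos_ne_zero hθ hd 0))
  obtain ⟨δ, hδ0, hδ⟩ := exists_between (lt_min hε one_pos)
  have hδε := hδ.trans_le (min_le_left _ _)
  have hδ1 := hδ.trans_le (min_le_right _ _)
  have hneg : ∀ t, -δ ≤ t → t < 0 → cos (θ t) ≠ 0 := fun t h1 h2 =>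
    H (by rw [Real.dist_eq, abs_lt]; constructor <;> linarith) h2.ne
  have hfin := (finite_cos_eq_zero hθ hd 0 1).subset
    (Set.inter_subset_inter_left {t | cos (θ t) = 0} Set.Ico_subset_Icc_self)
  -- There may be a crossing at `0`, so the path is read from `-δ` to `1 - δ`. By periodicity no
  -- crossing lies in `[-δ, 0)` or `[1 - δ, 1)`, so the list for `[0, 1)` is unchanged.
  obtain ⟨n, hn⟩ := exists_abs_sub_lt_of_cos_ne_zero (hneg (-δ) le_rfl (by linarith))
  have hmem : ∀ t, t ∈ hfin.toFinset.sort ↔ t ∈ Set.Ico (0 : ℝ) 1 ∧ cos (θ t) = 0 := fun t => by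
    rw [Finset.mem_sort, Set.Finite.mem_toFinset]; rfl
  refine ⟨d, hfin.toFinset.sort, by rw [hd0]; push_cast; ring,
    hfin.toFinset.sortedLT_sort.pairwise, hmem, ?_⟩
  rw [prod_crossingLetter hθ hd _ (-δ) (-δ + 1) n (n + 2 * d) (by linarith) hn ?_
    hfin.toFinset.sortedLT_sort.pairwise ?_]
  · exact inv_walk_mul_walk_add n d
  · rw [hshift _ (by linarith)]
    convert hn using 2
    push_cast
    ring
  · intro t
    rw [hmem]
    constructor
    · rintro ⟨⟨h1, h2⟩, h0⟩
      refine ⟨⟨by linarith, ?_⟩, h0⟩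
      by_contra! h
      exact hneg (t - 1) (by linarith) (by linarith) (by rw [← hcos, sub_add_cancel, h0])
    · rintro ⟨⟨h1, h2⟩, h0⟩
      refine ⟨⟨?_, by linarith⟩, h0⟩
      by_contra! h
      exact hneg t h1 h h0

/-! ### Application to fronts. -/

section Front

variable {X : Type*} [NormedAddCommGroup X] [NormedSpace ℝ X]
  {Ω : LinearMap.BilinForm ℝ X} {γ η : ℝ → X} {α κ : ℝ → ℝ}

theorem IsCurvaturePair.exists_pos_mul (h : IsCurvaturePair Ω γ η α κ) (t : ℝ) :
    ∃ c > 0, Ω (η t) (deriv γ t) = c * α t ∧ Ω (η t) (deriv η t) = c * κ t := by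
  obtain ⟨ξ, hξ, ha, hk⟩ := h t
  refine ⟨_, hξ.pos, ?_, ?_⟩
  · rw [ha, map_smul, smul_eq_mul, mul_comm]
  · rw [hk, map_smul, smul_eq_mul, mul_comm]

theorem IsCurvaturePair.apply_deriv_eq_zero_iff (h : IsCurvaturePair Ω γ η α κ) (t : ℝ) :
    Ω (η t) (deriv γ t) = 0 ↔ deriv γ t = 0 := by
  obtain ⟨ξ, hξ, ha, -⟩ := h t
  rw [ha, map_smul, smul_eq_mul, mul_eq_zero, smul_eq_zero, or_iff_left hξ.pos.ne',
    or_iff_left (norm_ne_zero_iff.1 (hξ.norm_eq_one ▸ one_ne_zero))]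

theorem IsOrdinaryCusp.apply_deriv_deriv_ne_zero (hdim : Module.finrank ℝ X = 2)
    (hΩ : Ω.IsAlt) (hΩnd : Ω.Nondegenerate) (hγ : IsClosedLegendreImmersion γ η) {t : ℝ}
    (ht : IsOrdinaryCusp γ t) : Ω (η t) (deriv (deriv γ) t) ≠ 0 := by
  have h2 : deriv (deriv γ) t ≠ 0 := by
    have := ht.2.ne_zero 0
    simpa [iteratedDeriv_succ] using this
  have hd : DifferentiableAt ℝ (deriv γ) t :=
    (hγ.smooth_curve.deriv' (n := ∞)).differentiable (by simp) t
  exact (birkhoffOrth_deriv_of_eq_zero hγ.smooth_normal.continuous.continuousAt hγ.orth ht.1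
    hd.hasDerivAt).apply_ne_zero hdim hΩ hΩnd (hγ.normal_ne_zero t) h2

theorem contDiff_apply_apply [FiniteDimensional ℝ X] (Ω : LinearMap.BilinForm ℝ X) {u v : ℝ → X}
    (hu : ContDiff ℝ ∞ u) (hv : ContDiff ℝ ∞ v) : ContDiff ℝ ∞ fun t => Ω (u t) (v t) := by
  have : ContDiff ℝ ∞ fun t => LinearMap.toContinuousBilinearMap Ω (u t) (v t) :=
    (contDiff_const.clm_apply hu).clm_apply hv
  exact this

theorem hasDerivAt_apply_apply [FiniteDimensional ℝ X] (Ω : LinearMap.BilinForm ℝ X) {u v : ℝ → X}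
    {u' v' : X} {t : ℝ} (hu : HasDerivAt u u' t) (hv : HasDerivAt v v' t) :
    HasDerivAt (fun t => Ω (u t) (v t)) (Ω u' (v t) + Ω (u t) v') t :=
  ((LinearMap.toContinuousBilinearMap Ω).hasFDerivAt.comp_hasDerivAt t hu).clm_apply hv

theorem exists_zigzag_eq_rotation (hdim : Module.finrank ℝ X = 2)
    (hΩ : Ω.IsAlt) (hΩnd : Ω.Nondegenerate) (hγ : IsClosedLegendreImmersion γ η)
    (hgen : IsGeneric γ η) (h : IsCurvaturePair Ω γ η α κ) :
    ∃ z : ℕ, IsZigzagNumber Ω γ η z ∧ IsRotationNumber (curvatureMap hγ h) z := by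
  have : FiniteDimensional ℝ X := Module.finite_of_finrank_pos (by omega)
  have hγ' : ContDiff ℝ ∞ (deriv γ) := hγ.smooth_curve.deriv'
  have hη' : ContDiff ℝ ∞ (deriv η) := hγ.smooth_normal.deriv'
  have hA := contDiff_apply_apply Ω hγ.smooth_normal hγ'
  have hK := contDiff_apply_apply Ω hγ.smooth_normal hη'
  -- No smoothness of `α`, `κ` is given; pairing with `η` rescales both by the same positive factor
  -- and yields smooth functions.
  set A : ℝ → ℝ := fun t => Ω (η t) (deriv γ t) with hAdef
  set K : ℝ → ℝ := fun t => Ω (η t) (deriv η t) with hKdef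
  have hne : ∀ t, (A t, K t) ≠ 0 := fun t h0 => by
    obtain ⟨c, hc, h1, h2⟩ := h.exists_pos_mul t
    have h3 : A t = 0 := congrArg Prod.fst h0
    have h4 : K t = 0 := congrArg Prod.snd h0
    have h5 := (mul_eq_zero.1 (h1.symm.trans h3)).resolve_left hc.ne'
    have h6 := (mul_eq_zero.1 (h2.symm.trans h4)).resolve_left hc.ne'
    exact h.ne_zero hγ t (by rw [h5, h6]; rfl)
  obtain ⟨θ, r, hr, hAθ, hKθ, hθ⟩ := exists_angle
    (fun t => (hA.differentiable (by simp) t).hasDerivAt)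
    (fun t => (hK.differentiable (by simp) t).hasDerivAt)
    (hA.continuous_deriv (by simp)) (hK.continuous_deriv (by simp)) hne
  have hθc : Continuous θ := continuous_iff_continuousAt.2 fun t => (hθ t).continuousAt
  have hzero : ∀ t, cos (θ t) = 0 ↔ IsOrdinaryCusp γ t := fun t => by
    have h1 : cos (θ t) = 0 ↔ A t = 0 := by rw [hAθ, mul_eq_zero, or_iff_right (hr t).ne']
    rw [h1]
    refine (h.apply_deriv_eq_zero_iff t).trans ⟨hgen.cusps t, fun h => h.1⟩
  have hd : ∀ t, cos (θ t) = 0 → ∃ c ≠ 0, HasDerivAt θ c t := fun t ht => by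
    refine ⟨_, ?_, hθ t⟩
    have hcusp := (hzero t).1 ht
    have hA0 : A t = 0 := by rw [hAθ, ht, mul_zero]
    have hK0 : K t ≠ 0 := fun h0 => hne t (by rw [hA0, h0]; rfl)
    have hA' : deriv A t = Ω (η t) (deriv (deriv γ) t) := by
      have := hasDerivAt_apply_apply Ω
        (hγ.smooth_normal.differentiable (by simp) t).hasDerivAt
        (hγ'.differentiable (by simp) t).hasDerivAt
      rw [hcusp.1, map_zero, zero_add] at this
      exact this.deriv
    rw [hA0, hA', zero_mul, zero_sub]
    have := hcusp.apply_deriv_deriv_ne_zero hdim hΩ hΩnd hγ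
    refine div_ne_zero (neg_ne_zero.2 (mul_ne_zero hK0 this)) ?_
    positivity
  have hη1 : Function.Periodic (deriv η) 1 := fun t => by
    rw [← deriv_comp_add_const, funext hγ.periodic_normal]
  have hγ1 : Function.Periodic (deriv γ) 1 := fun t => by
    rw [← deriv_comp_add_const, funext hγ.periodic_curve]
  have hper : ∀ t, ∃ n : ℤ, θ (t + 1) - θ t = n * (2 * π) := fun t =>
    exists_sub_eq_int_mul_two_pi (hr (t + 1)) (hr t)
      (by rw [← hAθ, ← hAθ]; simp only [hAdef, hγ.periodic_normal t, hγ1 t])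
      (by rw [← hKθ, ← hKθ]; simp only [hKdef, hγ.periodic_normal t, hη1 t])
  obtain ⟨d, l, hd1, hlt, hl, hprod⟩ := exists_list_crossings hθc hd hper
  have hlift : IsAngleLift (curvatureMap hγ h) θ := by
    refine ⟨hθc.continuousOn, fun t _ => ?_⟩
    obtain ⟨c, hc, h1, h2⟩ := h.exists_pos_mul t
    refine (Projectivization.mk_eq_mk_iff' ℝ _ _ _ _).2 ⟨r t / c, ?_⟩
    have h3 : c * α t = r t * cos (θ t) := h1.symm.trans (hAθ t)
    have h4 : c * κ t = r t * sin (θ t) := h2.symm.trans (hKθ t)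
    ext
    · simp only [Prod.smul_mk, smul_eq_mul]
      rw [div_mul_eq_mul_div, ← h3, mul_div_cancel_left₀ _ hc.ne']
    · simp only [Prod.smul_mk, smul_eq_mul]
      rw [div_mul_eq_mul_div, ← h4, mul_div_cancel_left₀ _ hc.ne']
  have hletter : cuspLetter Ω η = fun t => crossingLetter (θ t) := funext fun t => by
    have : 0 < Ω (η t) (deriv η t) ↔ 0 < sin (θ t) := by
      rw [show Ω (η t) (deriv η t) = r t * sin (θ t) from hKθ t, mul_pos_iff_of_pos_left (hr t)]
    simp only [cuspLetter, crossingLetter, this]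
  -- The angle grows by `2dπ`, and the degree counts multiples of `π`: hence the degree `2 * d`.
  refine ⟨d.natAbs, ⟨l, hlt, fun t => by rw [hl, hzero], by rwa [hletter]⟩, 2 * d,
    ⟨⟨θ, hlift⟩, fun φ hφ => by rw [hφ.sub_eq hlift, hd1]⟩, ?_⟩
  rw [abs_mul, Int.natCast_natAbs]; rfl

end Front

end NormedPlane

theorem theorem4p1 {X : Type*} [NormedAddCommGroup X] [NormedSpace ℝ X] [StrictConvexSpace ℝ X]
    (hdim : Module.finrank ℝ X = 2)
    (hsmooth : ∀ x : X, x ≠ 0 → DifferentiableAt ℝ (fun y : X => ‖y‖) x)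
    (Ω : LinearMap.BilinForm ℝ X) (hΩ : Ω.IsAlt) (hΩnd : Ω.Nondegenerate)
    (γ η : ℝ → X) (hγ : NormedPlane.IsClosedLegendreImmersion γ η)
    (hgen : NormedPlane.IsGeneric γ η) :
    (∃ α κ : ℝ → ℝ, NormedPlane.IsCurvaturePair Ω γ η α κ) ∧
    ∀ (α κ : ℝ → ℝ) (h : NormedPlane.IsCurvaturePair Ω γ η α κ),
      ∃ z : ℕ, NormedPlane.IsZigzagNumber Ω γ η z ∧
        NormedPlane.IsRotationNumber (NormedPlane.curvatureMap hγ h) z :=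
  ⟨hγ.exists_curvaturePair hdim hsmooth hΩ hΩnd,
    fun _ _ h => NormedPlane.exists_zigzag_eq_rotation hdim hΩ hΩnd hγ hgen h⟩
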